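/- All rings are associative with identity, not necessarily commutative, and subrings contain the identity of the ring. An element $x$ of a ring $R$ is called periodic if $x^m = x^n$ for two different positive integers $m, n$; a ring is periodic if each of its elements is periodic. A ring $R$ is called semi-nil clean if every $x \in R$ can be written as $x = a + b$ with $a \in R$ periodic and $b \in R$ nilpotent. Let ${\rm Nil}(R)$ denote the set of nilpotent elements of $R$ and ${\rm Z}(R)$ the center of $R$. Let $R$ be a semi-nil clean ring. Then: (1) Each central subring of $R$ (that is, each subring contained in ${\rm Z}(R)$) is a periodic ring. (2) If ${\rm Nil}(R) \subseteq {\rm Z}(R)$, then $R$ is a commutative periodic ring. -/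

import Mathlib

/-- An element `x` is periodic if `x ^ m = x ^ n` for two different positive integers `m`, `n`. -/
def IsPeriodicElem {R : Type*} [Monoid R] (x : R) : Prop :=
  ∃ m n : ℕ, 0 < m ∧ 0 < n ∧ m ≠ n ∧ x ^ m = x ^ n

/-- A ring is periodic if all its elements are periodic. -/
def IsPeriodicRing (R : Type*) [Ring R] : Prop :=
  ∀ x : R, IsPeriodicElem x

/-- An element is semi-nil clean if it is the sum of a periodic and a nilpotent element. -/
def IsSemiNilClean {R : Type*} [Ring R] (x : R) : Prop :=
  ∃ a b : R, IsPeriodicElem a ∧ IsNilpotent b ∧ x = a + b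

/-- A ring is semi-nil clean if all its elements are semi-nil clean. -/
def IsSemiNilCleanRing (R : Type*) [Ring R] : Prop :=
  ∀ x : R, IsSemiNilClean x

/-! If `x = a + b` with `a` periodic, `b` nilpotent and `a`, `b` commuting, some `x ^ n - x ^ m` is
nilpotent. Applied to `2`, this makes some `N > 0` vanish in `R`; then such an `x` is integral over
a finite ring `ZMod c`, so its powers are finite in number. Periodicity follows in both parts, since
centrality of `x` or of `b` makes `a` and `b` commute.

For commutativity, maximal left ideals are two-sided with periodic domains as quotients, and those
are commutative. Hence commutators are nilpotent, so central. Splitting `N` into prime powers, the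
identity `[z ^ q, y] = q z ^ (q - 1) [z, y]` with `q` a power of `p` kills them. -/

/-! ### Commuting sums and positive characteristic -/

theorem Commute.isNilpotent_pow_sub_pow {R : Type*} [Ring R] {x y : R} (h : Commute x y)
    (hn : IsNilpotent (x - y)) (n : ℕ) : IsNilpotent (x ^ n - y ^ n) := by
  rw [← h.mul_geom_sum₂ n]
  refine Commute.isNilpotent_mul_right ?_ hn
  refine Commute.sum_right _ _ _ fun i _ => ?_
  exact ((Commute.refl x).sub_left h.symm).pow_right i |>.mul_right
    ((h.sub_left (Commute.refl y)).pow_right _)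

theorem IsPeriodicElem.exists_lt {R : Type*} [Monoid R] {x : R} (h : IsPeriodicElem x) :
    ∃ m n : ℕ, 0 < m ∧ m < n ∧ x ^ m = x ^ n := by
  obtain ⟨m, n, hm, hn, hne, e⟩ := h
  rcases hne.lt_or_gt with h | h
  · exact ⟨m, n, hm, h, e⟩
  · exact ⟨n, m, hn, h, e.symm⟩

theorem IsPeriodicElem.exists_isNilpotent_add {R : Type*} [Ring R] {a b : R}
    (ha : IsPeriodicElem a) (hb : IsNilpotent b) (h : Commute a b) :
    ∃ m n : ℕ, 0 < m ∧ m < n ∧ IsNilpotent ((a + b) ^ n - (a + b) ^ m) := by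
  obtain ⟨m, n, hm, hmn, e⟩ := ha.exists_lt
  refine ⟨m, n, hm, hmn, ?_⟩
  have hx : Commute (a + b) a := (Commute.refl a).add_left h.symm
  have hs : IsNilpotent (a + b - a) := by simpa using hb
  have key := Commute.isNilpotent_sub (x := (a + b) ^ n - a ^ n) (y := (a + b) ^ m - a ^ m) ?_
    (hx.isNilpotent_pow_sub_pow hs n) (hx.isNilpotent_pow_sub_pow hs m)
  · simpa [e] using key
  · exact (((Commute.refl _).pow_pow _ _).sub_right (hx.pow_pow _ _)).sub_left
      ((hx.symm.pow_pow _ _).sub_right ((Commute.refl _).pow_pow _ _))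

theorem IsSemiNilCleanRing.exists_natCast_eq_zero {R : Type*} [Ring R]
    (hR : IsSemiNilCleanRing R) : ∃ N : ℕ, 0 < N ∧ (N : R) = 0 := by
  obtain ⟨a, b, ha, hb, e⟩ := hR 2
  have hab : Commute a b := by
    have : b = 2 - a := by rw [e]; abel
    rw [this]
    exact (Commute.ofNat_right a 2).sub_right (Commute.refl a)
  obtain ⟨m, n, -, hmn, k, hk⟩ := ha.exists_isNilpotent_add hb hab
  rw [← e] at hk
  have hlt : 2 ^ m < 2 ^ n := Nat.pow_lt_pow_right (by norm_num) hmn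
  refine ⟨(2 ^ n - 2 ^ m) ^ k, pow_pos (Nat.sub_pos_of_lt hlt) _, ?_⟩
  rw [Nat.cast_pow, Nat.cast_sub hlt.le]
  simpa using hk

theorem IsPeriodicElem.of_finite_mem {R : Type*} [Monoid R] {x : R} {s : Set R} (hs : s.Finite)
    (h : ∀ n : ℕ, x ^ n ∈ s) : IsPeriodicElem x := by
  obtain ⟨i, j, hij, e⟩ := hs.exists_lt_map_eq_of_forall_mem (f := fun n : ℕ => x ^ (n + 1))
    fun n => h _
  exact ⟨i + 1, j + 1, by omega, by omega, by omega, e⟩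

theorem isPeriodicElem_of_isNilpotent_pow_sub_pow {R : Type*} [Ring R] {N : ℕ} (hN : 0 < N)
    (hNR : (N : R) = 0) {x : R} {m n : ℕ} (hmn : m < n) (hx : IsNilpotent (x ^ n - x ^ m)) :
    IsPeriodicElem x := by
  have : NeZero N := ⟨hN.ne'⟩
  obtain ⟨c, hc⟩ := CharP.exists R
  have hd : c ∣ N := (CharP.cast_eq_zero_iff R c N).1 hNR
  have : NeZero c := ⟨fun h => hN.ne' (by simpa [h] using hd)⟩
  let : Algebra (ZMod c) R := ZMod.algebra R c
  obtain ⟨k, hk⟩ := hx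
  have hint : IsIntegral (ZMod c) x := by
    refine ⟨(Polynomial.X ^ n - Polynomial.X ^ m) ^ k, ?_, ?_⟩
    · refine Polynomial.Monic.pow (Polynomial.monic_X_pow_sub ?_) k
      exact (Polynomial.degree_X_pow_le m).trans_lt (by exact_mod_cast hmn)
    · rw [← Polynomial.aeval_def]
      simpa using hk
  have hf := hint.fg_adjoin_singleton
  have : Module.Finite (ZMod c) (Algebra.adjoin (ZMod c) {x}) :=
    Module.Finite.iff_fg.2 hf
  have : Finite (Algebra.adjoin (ZMod c) {x}) := Module.finite_of_finite (ZMod c)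
  exact .of_finite_mem (Set.toFinite (Algebra.adjoin (ZMod c) {x} : Set R)) fun n =>
    pow_mem (Algebra.self_mem_adjoin_singleton _ _) n

theorem IsSemiNilCleanRing.isPeriodicElem_of_commute {R : Type*} [Ring R]
    (hR : IsSemiNilCleanRing R) {a b : R} (ha : IsPeriodicElem a) (hb : IsNilpotent b)
    (h : Commute a b) : IsPeriodicElem (a + b) := by
  obtain ⟨N, hN, hNR⟩ := hR.exists_natCast_eq_zero
  obtain ⟨m, n, -, hmn, hx⟩ := ha.exists_isNilpotent_add hb h
  exact isPeriodicElem_of_isNilpotent_pow_sub_pow hN hNR hmn hx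

/-! ### Powers, idempotents and a commutator identity -/

theorem IsPeriodicElem.finite_powers {R : Type*} [Monoid R] {x : R} (h : IsPeriodicElem x) :
    (Set.range (x ^ · : ℕ → R)).Finite := by
  obtain ⟨m, n, -, hmn, e⟩ := h.exists_lt
  refine ((Set.finite_Iio n).image (x ^ · : ℕ → R)).subset ?_
  rintro _ ⟨i, rfl⟩
  induction i using Nat.strong_induction_on with
  | _ i ih =>
    by_cases hi : i < n
    · exact ⟨i, hi, rfl⟩
    · have : x ^ i = x ^ (m + (i - n)) := by
        rw [pow_add, e, ← pow_add]; congr 1; omega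
      simp only [this]
      exact ih _ (by omega)

theorem IsPeriodicElem.exists_pow_isIdempotentElem {R : Type*} [Monoid R] {x : R}
    (h : IsPeriodicElem x) : ∃ k : ℕ, 0 < k ∧ IsIdempotentElem (x ^ k) := by
  obtain ⟨m, n, hm, hmn, e⟩ := h.exists_lt
  have hstep : ∀ t s, m ≤ s → x ^ (s + t * (n - m)) = x ^ s := by
    intro t
    induction t with
    | zero => simp
    | succ t ih =>
      intro s hs
      have : s + (t + 1) * (n - m) = (s + (n - m)) + t * (n - m) := by ring
      rw [this, ih _ (by omega)]
      have h1 : s + (n - m) = n + (s - m) := by omega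
      rw [h1, pow_add, ← e, ← pow_add]
      congr 1; omega
  -- A multiple of the period `n - m` that is at least the preperiod `m`.
  refine ⟨m * (n - m), Nat.mul_pos hm (by omega), ?_⟩
  rw [IsIdempotentElem, ← pow_add]
  exact hstep m _ (Nat.le_mul_of_pos_right _ (by omega))

/-- The corners `e y (1 - e)` and `(1 - e) y e` square to zero, hence are central; commuting with
`e` then forces them to vanish. -/
theorem IsIdempotentElem.commute_of_isNilpotent_central {R : Type*} [Ring R]
    (hc : ∀ b : R, IsNilpotent b → ∀ y, Commute b y) {e : R} (he : IsIdempotentElem e) (y : R) :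
    Commute e y := by
  have hee : e * e = e := he
  have h1 : e * y * (1 - e) = 0 := by
    have hn : IsNilpotent (e * y * (1 - e)) := ⟨2, by
      rw [pow_two]
      calc e * y * (1 - e) * (e * y * (1 - e)) = e * y * (e - e * e) * (y * (1 - e)) := by
            noncomm_ring
        _ = 0 := by rw [hee]; simp⟩
    have := (hc _ hn e).eq
    calc e * y * (1 - e) = e * e * y * (1 - e) := by rw [hee]
      _ = e * (e * y * (1 - e)) := by noncomm_ring
      _ = e * y * (1 - e) * e := this.symm
      _ = e * y * (e - e * e) := by noncomm_ring
      _ = 0 := by rw [hee]; simp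
  have h2 : (1 - e) * y * e = 0 := by
    have hn : IsNilpotent ((1 - e) * y * e) := ⟨2, by
      rw [pow_two]
      calc (1 - e) * y * e * ((1 - e) * y * e) = (1 - e) * y * (e - e * e) * (y * e) := by
            noncomm_ring
        _ = 0 := by rw [hee]; simp⟩
    have := (hc _ hn e).eq
    calc (1 - e) * y * e = (1 - e) * y * (e * e) := by rw [hee]
      _ = (1 - e) * y * e * e := by noncomm_ring
      _ = e * ((1 - e) * y * e) := this
      _ = (e - e * e) * (y * e) := by noncomm_ring
      _ = 0 := by rw [hee]; simp
  have h3 : e * y = e * y * e := by rw [mul_sub, mul_one, sub_eq_zero] at h1; exact h1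
  have h4 : y * e = e * y * e := by
    rw [sub_mul, one_mul, sub_mul, sub_eq_zero] at h2; exact h2
  exact h3.trans h4.symm

theorem pow_mul_sub_mul_pow_of_commute {R : Type*} [Ring R] {z y : R}
    (h : Commute z (z * y - y * z)) (n : ℕ) :
    z ^ (n + 1) * y - y * z ^ (n + 1) = (n + 1 : ℕ) * (z ^ n * (z * y - y * z)) := by
  induction n with
  | zero => simp
  | succ n ih =>
    have h2 : z ^ (n + 1) * (z * y - y * z) = (z * y - y * z) * z ^ (n + 1) :=
      (h.pow_left (n + 1)).eq
    calc z ^ (n + 1 + 1) * y - y * z ^ (n + 1 + 1)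
        = z * (z ^ (n + 1) * y - y * z ^ (n + 1)) + (z * y - y * z) * z ^ (n + 1) := by
          rw [pow_succ' z (n + 1)]; noncomm_ring
      _ = (n + 1 + 1 : ℕ) * (z ^ (n + 1) * (z * y - y * z)) := by
          rw [ih, ← h2, ← mul_assoc, ← (Nat.cast_commute (n + 1) z).eq, mul_assoc, ← mul_assoc z,
            ← pow_succ', Nat.cast_succ (n + 1), add_mul, one_mul]

/-! ### Periodic domains -/

theorem Module.End.exists_apply_eq_smul_of_aeval_prod {K V : Type*} [Field K] [AddCommGroup V]
    [Module K V] (T : Module.End K V) (s : Finset K) {z : V} (hz : z ≠ 0)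
    (h : Polynomial.aeval T (∏ β ∈ s, (Polynomial.X - Polynomial.C β)) z = 0) :
    ∃ β ∈ s, ∃ w : V, w ≠ 0 ∧ T w = β • w := by
  classical
  induction s using Finset.induction_on generalizing z with
  | empty => simp [hz] at h
  | insert β s hβ ih =>
    by_cases h0 : T z = β • z
    · exact ⟨β, Finset.mem_insert_self _ _, z, hz, h0⟩
    · have hz' : T z - β • z ≠ 0 := sub_ne_zero.2 h0
      rw [Finset.prod_insert hβ, mul_comm, map_mul, Module.End.mul_apply] at h
      obtain ⟨γ, hγ, w, hw⟩ := ih hz' (by simpa [Module.algebraMap_end_apply] using h)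
      exact ⟨γ, Finset.mem_insert_of_mem hγ, w, hw⟩

/-- Right multiplication by `φ α` is linear for the left `K`-structure and is killed by `X ^ |K| -
X`, which splits into distinct linear factors. As `y` is not an `α`-eigenvector, another eigenvalue
occurs. -/
theorem exists_mul_eq_mul_of_not_commute {K D : Type*} [Field K] [Finite K] [Ring D]
    (φ : K →+* D) (α : K) {y : D} (hy : y * φ α ≠ φ α * y) :
    ∃ β, β ≠ α ∧ ∃ w : D, w ≠ 0 ∧ w * φ α = φ β * w := by
  classical
  have := Fintype.ofFinite K
  let : Module K D := Module.compHom D φ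
  have smul_def : ∀ (k : K) (x : D), k • x = φ k * x := fun _ _ => rfl
  let T : Module.End K D :=
    { toFun := fun x => x * φ α
      map_add' := fun x y => add_mul x y _
      map_smul' := fun k x => by simp [smul_def, mul_assoc] }
  have hT : ∀ x, T x = x * φ α := fun _ => rfl
  have hTpow : ∀ (n : ℕ) x, (T ^ n) x = x * φ α ^ n := by
    intro n
    induction n with
    | zero => simp
    | succ n ih => intro x; rw [pow_succ', Module.End.mul_apply, ih, hT, mul_assoc, ← pow_succ]
  have hprod : (Polynomial.X ^ Fintype.card K - Polynomial.X : Polynomial K) =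
      ∏ β : K, (Polynomial.X - Polynomial.C β) := by
    have hmonic : (Polynomial.X ^ Fintype.card K - Polynomial.X : Polynomial K).Monic := by
      refine Polynomial.monic_X_pow_sub (Polynomial.degree_X_le.trans_lt ?_)
      exact_mod_cast Fintype.one_lt_card
    have hr := FiniteField.roots_X_pow_card_sub_X K
    have := Polynomial.prod_multiset_X_sub_C_of_monic_of_roots_card_eq hmonic (by
      rw [hr, FiniteField.X_pow_card_sub_X_natDegree_eq K Fintype.one_lt_card]; simp)
    rw [hr] at this
    exact this.symm
  have h0 : ∀ x, Polynomial.aeval T (∏ β : K, (Polynomial.X - Polynomial.C β)) x = 0 := by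
    intro x
    rw [← hprod, map_sub, map_pow, Polynomial.aeval_X, LinearMap.sub_apply, hTpow, hT, ← map_pow,
      FiniteField.pow_card, sub_self]
  rw [← Finset.prod_erase_mul _ _ (Finset.mem_univ α)] at h0
  have hz : T y - α • y ≠ 0 := sub_ne_zero.2 hy
  obtain ⟨β, hβ, w, hw, e⟩ := Module.End.exists_apply_eq_smul_of_aeval_prod T (Finset.univ.erase α) hz (by
    have := h0 y
    rw [map_mul, Module.End.mul_apply] at this
    simpa [Module.algebraMap_end_apply] using this)
  exact ⟨β, Finset.ne_of_mem_erase hβ, w, hw, e⟩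

theorem Algebra.finite_adjoin_of_finite_closure {F A : Type*} [CommRing F] [Finite F] [Ring A]
    [Algebra F A] {s : Set A} (h : (Submonoid.closure s : Set A).Finite) :
    Finite (Algebra.adjoin F s) := by
  have hfg : (Subalgebra.toSubmodule (Algebra.adjoin F s)).FG := by
    rw [Algebra.adjoin_eq_span]
    exact Submodule.fg_span h
  have : Module.Finite F (Algebra.adjoin F s) := Module.Finite.iff_fg.2 hfg
  exact Module.finite_of_finite F

/-- Powers of `w` move past the finite ring generated by `a`, so the products `k * w ^ i` form a
finite monoid. Its span is a finite domain, commutative by Wedderburn's little theorem. -/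
theorem commute_of_finite_adjoin_singleton {F D : Type*} [CommRing F] [Finite F] [Ring D]
    [IsDomain D] [Algebra F D] {a b w : D} (ha : Finite (Algebra.adjoin F {a}))
    (hb : b ∈ Algebra.adjoin F {a}) (hw : IsPeriodicElem w) (h : w * a = b * w) : w * a = a * w := by
  have hconj : ∀ k ∈ Algebra.adjoin F {a}, ∃ k' ∈ Algebra.adjoin F {a}, w * k = k' * w := by
    intro k hk
    induction hk using Algebra.adjoin_induction with
    | mem x hx => rw [Set.mem_singleton_iff.1 hx]; exact ⟨b, hb, h⟩
    | algebraMap r => exact ⟨_, algebraMap_mem _ r, (Algebra.commutes r w).symm⟩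
    | add x y _ _ hx hy =>
      obtain ⟨x', hx', ex⟩ := hx
      obtain ⟨y', hy', ey⟩ := hy
      exact ⟨x' + y', add_mem hx' hy', by rw [mul_add, ex, ey, add_mul]⟩
    | mul x y _ _ hx hy =>
      obtain ⟨x', hx', ex⟩ := hx
      obtain ⟨y', hy', ey⟩ := hy
      exact ⟨x' * y', mul_mem hx' hy', by rw [← mul_assoc, ex, mul_assoc, ey, mul_assoc]⟩
  have hconj_pow : ∀ (n : ℕ), ∀ k ∈ Algebra.adjoin F {a}, ∃ k' ∈ Algebra.adjoin F {a},
      w ^ n * k = k' * w ^ n := by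
    intro n
    induction n with
    | zero => intro k hk; exact ⟨k, hk, by simp⟩
    | succ n ih =>
      intro k hk
      obtain ⟨k', hk', e⟩ := ih k hk
      obtain ⟨k'', hk'', e'⟩ := hconj k' hk'
      exact ⟨k'', hk'', by rw [pow_succ', mul_assoc, e, ← mul_assoc, e', mul_assoc]⟩
  let M : Submonoid D :=
    { carrier := Set.image2 (· * ·) (Algebra.adjoin F {a} : Set D) (Set.range (w ^ · : ℕ → D))
      one_mem' := ⟨1, one_mem _, 1, ⟨0, pow_zero w⟩, one_mul 1⟩
      mul_mem' := by
        rintro _ _ ⟨k, hk, _, ⟨i, rfl⟩, rfl⟩ ⟨l, hl, _, ⟨j, rfl⟩, rfl⟩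
        obtain ⟨l', hl', e⟩ := hconj_pow i l hl
        refine ⟨k * l', mul_mem hk hl', w ^ (i + j), ⟨i + j, rfl⟩, ?_⟩
        simp only
        rw [pow_add, mul_assoc k, ← mul_assoc l', ← e]
        noncomm_ring }
  have hM : (Submonoid.closure (M : Set D) : Set D).Finite := by
    rw [Submonoid.closure_eq]
    exact Set.Finite.image2 _ (Set.toFinite _) hw.finite_powers
  have := Algebra.finite_adjoin_of_finite_closure (F := F) hM
  have haM : a ∈ Algebra.adjoin F (M : Set D) := Algebra.subset_adjoin
    ⟨a, Algebra.self_mem_adjoin_singleton F a, 1, ⟨0, pow_zero w⟩, mul_one a⟩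
  have hwM : w ∈ Algebra.adjoin F (M : Set D) := Algebra.subset_adjoin
    ⟨1, one_mem _, w, ⟨1, pow_one w⟩, one_mul w⟩
  exact congrArg Subtype.val
    ((Finite.isDomain_to_isField (Algebra.adjoin F (M : Set D))).mul_comm ⟨w, hwM⟩ ⟨a, haM⟩)

/-- A periodic domain is commutative. -/
theorem IsPeriodicRing.mul_comm_of_isDomain {D : Type*} [Ring D] [IsDomain D]
    (hD : IsPeriodicRing D) (x y : D) : x * y = y * x := by
  by_contra hxy
  obtain ⟨p, hp⟩ := CharP.exists D
  have hp0 : p ≠ 0 := by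
    rintro rfl
    have := CharP.charP_to_charZero D
    obtain ⟨m, n, -, -, hmn, e⟩ := hD 2
    exact hmn (Nat.pow_right_injective le_rfl (by exact_mod_cast e : (2 : ℕ) ^ m = 2 ^ n))
  have : NeZero p := ⟨hp0⟩
  let : Algebra (ZMod p) D := ZMod.algebra D p
  have hfin : Finite (Algebra.adjoin (ZMod p) {y}) := by
    refine Algebra.finite_adjoin_of_finite_closure ?_
    rw [← Submonoid.powers_eq_closure]
    exact (hD y).finite_powers
  let : Field (Algebra.adjoin (ZMod p) {y}) := (Finite.isDomain_to_isField _).toField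
  obtain ⟨β, hβ, w, hw, e⟩ := exists_mul_eq_mul_of_not_commute
    (Algebra.adjoin (ZMod p) {y}).val.toRingHom ⟨y, Algebra.self_mem_adjoin_singleton _ y⟩ hxy
  have e' : w * y = β * w := e
  refine hβ (Subtype.ext (mul_right_cancel₀ hw ?_))
  exact e'.symm.trans (commute_of_finite_adjoin_singleton hfin β.2 (hD w) e')

/-! ### Nilpotence of commutators -/

theorem IsPeriodicRing.isTwoSided_of_isNilpotent_central {R : Type*} [Ring R]
    (hp : IsPeriodicRing R) (hc : ∀ b : R, IsNilpotent b → ∀ y, Commute b y) (I : Ideal R) :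
    I.IsTwoSided := by
  refine ⟨fun {x} y hx => ?_⟩
  obtain ⟨k, hk, he⟩ := (hp x).exists_pow_isIdempotentElem
  have hxe : x ^ k ∈ I := by
    obtain ⟨k, rfl⟩ := Nat.exists_eq_succ_of_ne_zero hk.ne'
    rw [pow_succ]
    exact I.mul_mem_left _ hx
  have hnil : IsNilpotent (x - x * x ^ k) := by
    refine ⟨k, ?_⟩
    have h1 : x - x * x ^ k = x * (1 - x ^ k) := by rw [mul_sub, mul_one]
    have h2 : Commute x (1 - x ^ k) := (Commute.one_right x).sub_right ((Commute.refl x).pow_right k)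
    rw [h1, h2.mul_pow, he.one_sub.pow_eq hk.ne', mul_sub, mul_one, he.eq, sub_self]
  have h1 : x * y = y * (x - x * x ^ k) + x * y * x ^ k := by
    rw [← (hc _ hnil y).eq, mul_assoc x y,
      ← (he.commute_of_isNilpotent_central hc y).eq]
    noncomm_ring
  rw [h1]
  exact I.add_mem (I.mul_mem_left _ (I.sub_mem hx (I.mul_mem_left _ hxe))) (I.mul_mem_left _ hxe)

theorem Ideal.IsMaximal.isDomain_quotient_of_isTwoSided {R : Type*} [Ring R] {M : Ideal R}
    (hM : M.IsMaximal) [M.IsTwoSided] : IsDomain (R ⧸ M) := by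
  have : Nontrivial (R ⧸ M) := Ideal.Quotient.nontrivial_iff.2 hM.ne_top
  have : NoZeroDivisors (R ⧸ M) := by
    refine ⟨fun {a b} hab => ?_⟩
    obtain ⟨x, rfl⟩ := Ideal.Quotient.mk_surjective a
    refine or_iff_not_imp_left.2 fun hx => ?_
    obtain ⟨y, i, hi, e⟩ := hM.exists_inv (mt Ideal.Quotient.eq_zero_iff_mem.2 hx)
    have h1 : Ideal.Quotient.mk M y * Ideal.Quotient.mk M x = 1 := by
      rw [← map_mul, ← map_one (Ideal.Quotient.mk M), ← e, map_add,
        Ideal.Quotient.eq_zero_iff_mem.2 hi, add_zero]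
    rw [← one_mul b, ← h1, mul_assoc, hab, mul_zero]
  exact NoZeroDivisors.to_isDomain _

theorem IsPeriodicRing.isNilpotent_mul_sub_mul {R : Type*} [Ring R]
    (hp : IsPeriodicRing R) (hc : ∀ b : R, IsNilpotent b → ∀ y, Commute b y) (x y : R) :
    IsNilpotent (x * y - y * x) := by
  obtain ⟨k, hk, he⟩ := (hp (x * y - y * x)).exists_pow_isIdempotentElem
  refine ⟨k, ?_⟩
  by_contra h0
  -- A maximal left ideal above `1 - e`, for the nonzero idempotent `e`, would contain `e` too, its
  -- quotient being commutative.
  have hI : Ideal.span {1 - (x * y - y * x) ^ k} ≠ ⊤ := by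
    intro h
    have h1 : (1 : R) ∈ Ideal.span {1 - (x * y - y * x) ^ k} := h ▸ Submodule.mem_top
    obtain ⟨r, hr⟩ := Ideal.mem_span_singleton'.1 h1
    apply h0
    calc (x * y - y * x) ^ k = r * (1 - (x * y - y * x) ^ k) * (x * y - y * x) ^ k := by
          rw [hr, one_mul]
      _ = 0 := by rw [mul_assoc, sub_mul, one_mul, he.eq, sub_self, mul_zero]
  obtain ⟨M, hM, hle⟩ := Ideal.exists_le_maximal _ hI
  have := hp.isTwoSided_of_isNilpotent_central hc M
  have := hM.isDomain_quotient_of_isTwoSided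
  have hpM : IsPeriodicRing (R ⧸ M) := by
    intro a
    obtain ⟨a, rfl⟩ := Ideal.Quotient.mk_surjective a
    obtain ⟨m, n, hm, hn, hmn, e⟩ := hp a
    exact ⟨m, n, hm, hn, hmn, by rw [← map_pow, e, map_pow]⟩
  have hcM : x * y - y * x ∈ M := by
    rw [← Ideal.Quotient.eq_zero_iff_mem, map_sub, map_mul, map_mul,
      hpM.mul_comm_of_isDomain, sub_self]
  apply hM.ne_top
  rw [Ideal.eq_top_iff_one]
  have h2 : (x * y - y * x) ^ k ∈ M := M.pow_mem_of_mem hcM k hk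
  have h3 := hle (Ideal.mem_span_singleton_self (1 - (x * y - y * x) ^ k))
  simpa using M.add_mem h3 h2

/-! ### Prime-power torsion -/

theorem IsPeriodicElem.exists_isNilpotent_sub_pow_prime_pow {R : Type*} [Ring R] {z : R}
    (hz : IsPeriodicElem z) {p a : ℕ} (hp : p.Prime) (h : (p ^ a : ℕ) * z = 0) :
    ∃ r, 0 < r ∧ IsNilpotent (z - z ^ p ^ r) := by
  obtain ⟨i, j, hij, e⟩ := Set.Finite.exists_lt_map_eq_of_forall_mem
    (f := fun i : ℕ => z ^ p ^ i) (t := Set.range (z ^ · : ℕ → R)) (fun i => ⟨p ^ i, rfl⟩)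
    hz.finite_powers
  refine ⟨j - i, by omega, ?_⟩
  have hcomm : Commute (z - z ^ p ^ (j - i)) (z ^ p ^ (j - i)) :=
    ((Commute.refl z).pow_right _).sub_left (Commute.refl _)
  obtain ⟨r, hr⟩ : ∃ r, (z - z ^ p ^ (j - i) + z ^ p ^ (j - i)) ^ p ^ i =
      (z - z ^ p ^ (j - i)) ^ p ^ i + (z ^ p ^ (j - i)) ^ p ^ i + p * r := by
    obtain ⟨r, hr⟩ := hcomm.exists_add_pow_prime_pow_eq hp i
    exact ⟨_, hr.trans (by rw [mul_assoc (p : R), mul_assoc (p : R)])⟩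
  have hji : z ^ (p ^ (j - i) * p ^ i) = z ^ p ^ j := by
    rw [← pow_add]; congr 2; omega
  rw [sub_add_cancel, ← pow_mul, hji, e] at hr
  set w := z - z ^ p ^ (j - i) with hw
  have hw1 : w ^ p ^ i = p * -r := by
    have : w ^ p ^ i + p * r = 0 := by
      have h5 : z ^ p ^ j + (w ^ p ^ i + p * r) = z ^ p ^ j := by
        conv_rhs => rw [hr]
        abel
      simpa using h5
    rw [mul_neg, eq_neg_iff_add_eq_zero, this]
  have hw0 : (p ^ a : ℕ) * w = 0 := by
    have : z ^ p ^ (j - i) = z * z ^ (p ^ (j - i) - 1) := by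
      rw [← pow_succ', Nat.sub_add_cancel (Nat.pos_of_ne_zero (pow_ne_zero _ hp.ne_zero))]
    rw [hw, this, mul_sub, ← mul_assoc, h, zero_mul, sub_zero]
  -- The extra factor `w` is what `p ^ a` annihilates; nothing is known about `r`.
  refine ⟨p ^ i * a + 1, ?_⟩
  rw [pow_succ, pow_mul, hw1, (Nat.cast_commute p (-r)).mul_pow, ← Nat.cast_pow,
    (Nat.cast_commute (p ^ a) _).eq, mul_assoc, hw0, mul_zero]

theorem IsPeriodicRing.commute_of_prime_pow_mul_eq_zero {R : Type*} [Ring R]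
    (hR : IsPeriodicRing R) (hc : ∀ b : R, IsNilpotent b → ∀ y, Commute b y) {p a : ℕ}
    (hp : p.Prime) {z : R} (h : (p ^ a : ℕ) * z = 0) (y : R) : Commute z y := by
  obtain ⟨r, hr, hn⟩ := (hR z).exists_isNilpotent_sub_pow_prime_pow hp h
  have h1 := (hc _ hn y).eq
  have hcz : Commute z (z * y - y * z) := (hc _ (hR.isNilpotent_mul_sub_mul hc z y) z).symm
  have h2 := pow_mul_sub_mul_pow_of_commute hcz (p ^ r - 1)
  rw [Nat.sub_add_cancel (Nat.pos_of_ne_zero (pow_ne_zero _ hp.ne_zero))] at h2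
  have h3 : z * y - y * z = z ^ p ^ r * y - y * z ^ p ^ r := by
    rw [sub_mul, mul_sub, sub_eq_sub_iff_sub_eq_sub] at h1
    exact h1
  rw [h2, ← mul_assoc] at h3
  -- The commutator reproduces itself with a factor `p ^ r`; since `r > 0`, `a` iterations reach the
  -- torsion exponent.
  have h4 : ∀ t : ℕ, z * y - y * z = ((p ^ r : ℕ) * z ^ (p ^ r - 1)) ^ t * (z * y - y * z) := by
    intro t
    induction t with
    | zero => simp
    | succ t ih => rw [pow_succ, mul_assoc, ← h3]; exact ih
  have h5 := h4 a
  have h6 : ((p ^ r : ℕ) : R) ^ a * (z * y - y * z) = 0 := by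
    have h7 : ((p ^ a : ℕ) : R) * (z * y - y * z) = 0 := by
      rw [mul_sub, ← mul_assoc, ← mul_assoc, h, (Nat.cast_commute (p ^ a) y).eq, mul_assoc, h]
      simp
    rw [← Nat.cast_pow, ← pow_mul, show r * a = (r - 1) * a + a by
      obtain ⟨r, rfl⟩ := Nat.exists_eq_succ_of_ne_zero hr.ne'
      simp [Nat.succ_mul], pow_add, Nat.cast_mul, mul_assoc, h7, mul_zero]
  rw [(Nat.cast_commute (p ^ r) _).mul_pow, ((Nat.cast_commute (p ^ r) _).pow_pow a a).eq,
    mul_assoc, h6, mul_zero, sub_eq_zero] at h5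
  exact h5

theorem IsPeriodicRing.commute_of_natCast_mul_eq_zero {R : Type*} [Ring R]
    (hR : IsPeriodicRing R) (hc : ∀ b : R, IsNilpotent b → ∀ y, Commute b y) {N : ℕ}
    (hN : N ≠ 0) {z : R} (h : (N : R) * z = 0) (y : R) : Commute z y := by
  induction N using Nat.recOnPosPrimePosCoprime generalizing z with
  | prime_pow p n hp _ => exact hR.commute_of_prime_pow_mul_eq_zero hc hp h y
  | zero => exact absurd rfl hN
  | one => simp [show z = 0 by simpa using h]
  | coprime a b ha hb hab iha ihb =>
    have h1 : Commute ((b : R) * z) y := iha (by omega) (by rw [← mul_assoc, ← Nat.cast_mul, h])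
    have h2 : Commute ((a : R) * z) y := ihb (by omega) (by
      rw [← mul_assoc, ← Nat.cast_mul, mul_comm b a, h])
    obtain ⟨u, v, huv⟩ := Nat.isCoprime_iff_coprime.2 hab
    have h3 : z = (u : R) * ((a : R) * z) + (v : R) * ((b : R) * z) := by
      rw [← mul_assoc, ← mul_assoc, ← add_mul]
      have : (u : R) * (a : R) + (v : R) * (b : R) = 1 := by exact_mod_cast congrArg (Int.cast (R := R)) huv
      rw [this, one_mul]
    rw [h3]
    exact ((Int.cast_commute u y).mul_left h2).add_left ((Int.cast_commute v y).mul_left h1)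

theorem mainTheorem9 {R : Type*} [Ring R] (hR : IsSemiNilCleanRing R) :
    (∀ S : Subring R, S ≤ Subring.center R → IsPeriodicRing S) ∧
    ({x : R | IsNilpotent x} ⊆ (Subring.center R : Set R) →
      (∀ x y : R, x * y = y * x) ∧ IsPeriodicRing R) := by
  constructor
  · intro S hS x
    obtain ⟨a, b, ha, hb, e⟩ := hR (x : R)
    have hxa : Commute (x : R) a := (Subring.mem_center_iff.1 (hS x.2) a).symm
    have hab : Commute a b := by
      rw [show b = x - a by rw [e]; abel]
      exact hxa.symm.sub_right (Commute.refl a)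
    obtain ⟨m, n, hm, hn, hmn, h⟩ := hR.isPeriodicElem_of_commute ha hb hab
    rw [← e] at h
    exact ⟨m, n, hm, hn, hmn, Subtype.ext (by simpa using h)⟩
  · intro hnil
    have hc : ∀ b : R, IsNilpotent b → ∀ y, Commute b y := fun b hb y =>
      (Subring.mem_center_iff.1 (hnil hb) y).symm
    have hp : IsPeriodicRing R := by
      intro x
      obtain ⟨a, b, ha, hb, rfl⟩ := hR x
      exact hR.isPeriodicElem_of_commute ha hb (hc b hb a).symm
    obtain ⟨N, hN, hN0⟩ := hR.exists_natCast_eq_zero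
    exact ⟨fun x y => hp.commute_of_natCast_mul_eq_zero hc hN.ne' (by rw [hN0, zero_mul]) y, hp⟩
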